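/- **Setting.** For $L,N\in\mathbb N_0$ let $\Omega_{L,N}=\{\eta\in\mathbb N_0^L:\sum_{i=1}^L\eta_i=N\}$. Given nonnegative rates $u_{1,L},u_{2,L}:\mathbb N_0\to[0,\infty)$, the inclusion process on $\Omega_{L,N}$ is the continuous-time Markov chain with càdlàg paths and generator $$\mathfrak L_{L,N}f(\eta)=\sum_{i,j=1}^L u_{1,L}(\eta_i)\,u_{2,L}(\eta_j)\,\big[f(\eta^{i,j})-f(\eta)\big],$$ where $\eta^{i,j}$ is the configuration obtained from $\eta$ when one particle jumps from site $i$ to site $j$ (no jump occurs from an empty site). Fix a threshold $A\in\mathbb N_0$ and assume that there are constants $q_k$ ($1\le k\le A$) and $r_k$ ($0\le k\le A$) with $r_k\ge q_k>0$ for $1\le k\le A$ and $r_k>0$ for $0\le k\le A$, and a sequence $\zeta_L=\mathcal O(1/L)$, such that for every $L\ge1$: * (slow phase) $|u_{1,L}(k)L-q_k|\le\zeta_L$ for $1\le k\le A$ and $|u_{2,L}(k)L-r_k|\le\zeta_L$ for $0\le k\le A$; * (fast phase) $\sup_{n>A}|u_{\iota,L}(n)-(n-A)|\le\zeta_L$ for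 $\iota=1,2$. For $\eta\in\Omega_{L,N}$ let $\#_{>A}\eta=\#\{i:\eta_i>A\}$ and let $\gamma_N(\eta)=\frac1N\sum_{i=1}^L\max\{\eta_i-A,0\}$ be the mass fraction in the fast phase. **Proposition (instantaneous condensation).** Let $\rho>0$, and let $L=L_n\to\infty$, $N=N_n\to\infty$ with $N/L\to\rho$. Let $\eta^{(L,N)}$ be the inclusion process with rates as above, started from deterministic configurations $\overline\eta^{(L,N)}\in\Omega_{L,N}$ such that $\gamma_N(\overline\eta^{(L,N)})$ converges to a limit in $[0,1]$. Then for every $T\in(0,\infty)$ $$\int_0^T\frac{\#_{>A}\eta^{(L,N)}(t)}{L}\,\mathrm dt\longrightarrow0\quad\text{in probability},$$ that is, for every $\varepsilon>0$, $\ \mathbf P\Big(\int_0^T\frac{\#_{>A}\eta^{(L,N)}(t)}{L}\,\mathrm dt\ge\varepsilon\Big)\to0$. -/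

import Mathlib

open MeasureTheory Filter Topology
open scoped NNReal

namespace InclusionProcess

/-- Configurations of `N` indistinguishable particles on `L` sites:
the set `Ω_{L,N} = {η ∈ ℕ₀^L : ∑ i, η i = N}`. -/
abbrev Config (L N : ℕ) : Type := {η : Fin L → ℕ // ∑ i, η i = N}

instance instFintypeConfig (L N : ℕ) : Fintype (Config L N) :=
  Fintype.subtype (Finset.piAntidiag Finset.univ N) (by
    intro η
    simp)

/-- The occupation numbers after one particle has jumped from `i` to `j`
(a jump from an empty site does nothing). -/
def moveFun {L : ℕ} (i j : Fin L) (η : Fin L → ℕ) : Fin L → ℕ :=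
  if η i = 0 then η else fun k => (η k - if k = i then 1 else 0) + if k = j then 1 else 0

theorem sum_moveFun {L : ℕ} (i j : Fin L) (η : Fin L → ℕ) :
    ∑ k, moveFun i j η k = ∑ k, η k := by
  unfold moveFun
  split_ifs with h
  · rfl
  · have hle : ∀ k ∈ (Finset.univ : Finset (Fin L)), (if k = i then 1 else 0) ≤ η k := by
      intro k _
      split_ifs with hk
      · subst hk
        omega
      · exact Nat.zero_le _
    have hi : 1 ≤ ∑ k, η k :=
      le_trans (by omega) (Finset.single_le_sum (f := η) (fun _ _ => Nat.zero_le _)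
        (Finset.mem_univ i))
    rw [Finset.sum_add_distrib, Finset.sum_tsub_distrib _ hle]
    simp only [Finset.sum_ite_eq', Finset.mem_univ, if_true]
    omega

/-- The configuration `η^{i,j}`, obtained from `η` when one particle jumps from `i` to `j`. -/
def Config.move {L N : ℕ} (i j : Fin L) (η : Config L N) : Config L N :=
  ⟨moveFun i j η.1, (sum_moveFun i j η.1).trans η.2⟩

/-- The generator
`𝔏 f(η) = ∑_{i,j} u₁(η_i) u₂(η_j) (f(η^{i,j}) - f(η))`, acting on functions on `Ω_{L,N}`. -/
def generator (u₁ u₂ : ℕ → ℝ) (L N : ℕ) : (Config L N → ℝ) →ₗ[ℝ] (Config L N → ℝ) where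
  toFun f := fun η => ∑ i, ∑ j, u₁ (η.1 i) * u₂ (η.1 j) * (f (η.move i j) - f η)
  map_add' f g := by
    funext η
    simp only [Pi.add_apply, ← Finset.sum_add_distrib]
    refine Finset.sum_congr rfl fun i _ => Finset.sum_congr rfl fun j _ => ?_
    ring
  map_smul' c f := by
    funext η
    simp only [Pi.smul_apply, smul_eq_mul, RingHom.id_apply, Finset.mul_sum]
    refine Finset.sum_congr rfl fun i _ => Finset.sum_congr rfl fun j _ => ?_
    ring

/-- The Markov semigroup `exp (t 𝔏)` on the finite-dimensional space of functions on `Ω_{L,N}`. -/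
noncomputable def semigroup (u₁ u₂ : ℕ → ℝ) (L N : ℕ) (t : ℝ≥0) :
    (Config L N → ℝ) →L[ℝ] (Config L N → ℝ) :=
  NormedSpace.exp ((t : ℝ) • LinearMap.toContinuousLinearMap (generator u₁ u₂ L N))

/-- The σ-algebra generated by the process up to time `s`. -/
abbrev past {Ω : Type*} {L N : ℕ} (η : ℝ≥0 → Ω → Config L N) (s : ℝ≥0) : MeasurableSpace Ω :=
  ⨆ r : Set.Iic s, MeasurableSpace.comap (η r) inferInstance

/-- `η` is the inclusion process with rates `u₁, u₂` started from `η₀`: a process on `Ω_{L,N}` with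
càdlàg paths (for the discrete topology) which is Markov with transition semigroup `exp (t 𝔏)`. -/
structure IsInclusionProcess {Ω : Type*} [MeasurableSpace Ω] (P : Measure Ω)
    (u₁ u₂ : ℕ → ℝ) {L N : ℕ} (η₀ : Config L N) (η : ℝ≥0 → Ω → Config L N) : Prop where
  measurable : ∀ t, Measurable (η t)
  right_continuous : ∀ ω t, ∀ᶠ s in 𝓝[>] t, η s ω = η t ω
  left_limits : ∀ ω t, ∃ x, ∀ᶠ s in 𝓝[<] t, η s ω = x
  initial : ∀ᵐ ω ∂P, η 0 ω = η₀
  markov : ∀ (s t : ℝ≥0) (f : Config L N → ℝ),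
    P[fun ω => f (η (s + t) ω) | past η s] =ᵐ[P] fun ω => semigroup u₁ u₂ L N t f (η s ω)

/-- The two-phase assumption, with threshold `A`, on families of jump rates
`u₁ L k` and `u₂ L k` (`L` the number of sites, `k` an occupation number). -/
def SlowPhaseRates (A : ℕ) (u₁ u₂ : ℕ → ℕ → ℝ) : Prop :=
  (∀ L k, 0 ≤ u₁ L k ∧ 0 ≤ u₂ L k) ∧
  ∃ (q r : ℕ → ℝ) (ζ : ℕ → ℝ),
    ζ =O[atTop] (fun L : ℕ => 1 / (L : ℝ)) ∧
    (∀ k, 1 ≤ k → k ≤ A → 0 < q k ∧ q k ≤ r k) ∧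
    (∀ k, k ≤ A → 0 < r k) ∧
    ∀ L : ℕ, 1 ≤ L →
      (∀ k, 1 ≤ k → k ≤ A → |u₁ L k * L - q k| ≤ ζ L) ∧
      (∀ k, k ≤ A → |u₂ L k * L - r k| ≤ ζ L) ∧
      (∀ n, A < n → |u₁ L n - ((n : ℝ) - A)| ≤ ζ L ∧ |u₂ L n - ((n : ℝ) - A)| ≤ ζ L)

/-- `#_{>A} η`, the number of sites with more than `A` particles. -/
def numAbove (A : ℕ) {L N : ℕ} (η : Config L N) : ℕ :=
  (Finset.univ.filter fun i => A < η.1 i).card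

/-- `γ_N(η) = ∑_i (η_i - A)⁺ / N`, the mass fraction in the fast phase
(the truncated subtraction of natural numbers is the positive part). -/
noncomputable def fastMass (A : ℕ) {L N : ℕ} (η : Config L N) : ℝ :=
  ∑ i, ((η.1 i - A : ℕ) : ℝ) / N

end InclusionProcess

/-! Write k = (η_i - A)⁺. Up to errors of order 1/L in each factor, a jump from i to j has rate k_i
k_j, so the fast phase is almost an inclusion process without diffusion. The Lyapunov function F = ∑
k/(k+1) is bounded by L and concave in each k, and its drift is at most -M S + O(L + N). Here M is
the total excess and S = ∑ 2/((k+1)(k+2)) over sites above A (`generator_lyapunov_le`). Dynkin's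
formula and 0 ≤ F ≤ L then give E∫ M S dt = O(L), whatever the initial configuration.

Since S ≤ M, this controls S² on a scale far below L², so S/L is small on time average. A site above
A either has excess at least K, which happens for at most N/K sites, or has weight bounded below in
terms of K. Hence the expected time integral of #_{>A}/L is at most Tρ/K plus a vanishing term
(`integral_numAbove_div_le`). Markov's inequality finishes the proof. -/

namespace InclusionProcess

/-! ### Joint measurability, Dynkin's formula and Markov's inequality for the process. -/

variable {Ω : Type*} [MeasurableSpace Ω] {P : Measure Ω}
  {u₁ u₂ : ℕ → ℝ} {L N : ℕ} {η₀ : Config L N} {η : ℝ≥0 → Ω → Config L N}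

theorem IsInclusionProcess.measurable_comp_countable (h : IsInclusionProcess P u₁ u₂ η₀ η)
    (f : Config L N → ℝ) (b : ℕ → ℝ≥0) {m : ℝ → ℕ} (hm : Measurable m) :
    Measurable fun p : ℝ × Ω => f (η (b (m p.1)) p.2) := by
  have h1 : Measurable fun p : ℕ × Ω => f (η (b p.1) p.2) :=
    measurable_from_prod_countable_right fun k =>
      Measurable.of_discrete.comp (h.measurable (b k))
  exact h1.comp ((hm.comp measurable_fst).prodMk measurable_snd)

/-- Right-continuity makes the process a pointwise limit of versions read off at grid times of mesh
1/(n+1). -/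
theorem IsInclusionProcess.measurable_uncurry (h : IsInclusionProcess P u₁ u₂ η₀ η)
    (f : Config L N → ℝ) :
    Measurable fun p : ℝ × Ω => f (η p.1.toNNReal p.2) := by
  let m : ℕ → ℝ → ℕ := fun n t => ⌊((n : ℝ) + 1) * t⌋₊
  have hm (n : ℕ) : Measurable (m n) := Nat.measurable_floor.comp (measurable_id.const_mul _)
  -- The `+ 1` in the numerator puts the grid time strictly after t, as the punctured filter `𝓝[>]
  -- t` requires.
  let b : ℕ → ℕ → ℝ≥0 := fun n k => ((k : ℝ≥0) + 1) / (n + 1)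
  let a : ℕ → ℝ → ℝ≥0 := fun n t => b n (m n t)
  refine measurable_of_tendsto_metrizable (f := fun n (p : ℝ × Ω) => f (η (a n p.1) p.2)) ?_ ?_
  · exact fun n => h.measurable_comp_countable f (b n) (hm n)
  · rw [tendsto_pi_nhds]
    rintro ⟨t, ω⟩
    have hcoe (n : ℕ) : ((a n t : ℝ≥0) : ℝ) = (⌊((n : ℝ) + 1) * t⌋₊ + 1) / (n + 1) := by
      simp [a, b, m]
    have hgt (n : ℕ) : t.toNNReal < a n t := by
      rw [← NNReal.coe_lt_coe, hcoe, Real.coe_toNNReal']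
      refine max_lt ?_ (by positivity)
      rw [lt_div_iff₀' (by positivity)]
      exact Nat.lt_floor_add_one _
    have hle (n : ℕ) : a n t ≤ t.toNNReal + 1 / (n + 1) := by
      rw [← NNReal.coe_le_coe, hcoe, NNReal.coe_add, add_div]
      push_cast
      gcongr
      rw [div_le_iff₀' (by positivity), Real.coe_toNNReal']
      rcases le_total t 0 with ht | ht
      · rw [Nat.floor_of_nonpos (mul_nonpos_of_nonneg_of_nonpos (by positivity) ht)]
        simp [ht]
      · rw [max_eq_left ht]
        exact Nat.floor_le (by positivity)
    have ha : Tendsto (fun n => a n t) atTop (𝓝[>] t.toNNReal) := by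
      refine tendsto_nhdsWithin_iff.2 ⟨?_, Eventually.of_forall hgt⟩
      refine tendsto_of_tendsto_of_tendsto_of_le_of_le tendsto_const_nhds ?_
        (fun n => (hgt n).le) hle
      simpa using (tendsto_one_div_add_atTop_nhds_zero_nat (𝕜 := ℝ≥0)).const_add t.toNNReal
    refine tendsto_const_nhds.congr' ?_
    filter_upwards [ha.eventually (h.right_continuous ω t.toNNReal)] with n hn
    rw [hn]

variable [IsProbabilityMeasure P]

theorem IsInclusionProcess.integral_comp_eq_semigroup (h : IsInclusionProcess P u₁ u₂ η₀ η)
    (f : Config L N → ℝ) (t : ℝ≥0) :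
    ∫ ω, f (η t ω) ∂P = semigroup u₁ u₂ L N t f η₀ := by
  have hm : past η 0 ≤ ‹MeasurableSpace Ω› := iSup_le fun r => (h.measurable r).comap_le
  have h1 := integral_condExp (μ := P) hm (f := fun ω => f (η (0 + t) ω))
  rw [zero_add] at h1
  rw [← h1]
  have h2 := h.markov 0 t f
  rw [zero_add] at h2
  rw [integral_congr_ae h2]
  have h3 : (fun ω => semigroup u₁ u₂ L N t f (η 0 ω)) =ᵐ[P]
      fun _ => semigroup u₁ u₂ L N t f η₀ := by
    filter_upwards [h.initial] with ω hω
    rw [hω]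
  rw [integral_congr_ae h3]
  simp

theorem hasDerivAt_exp_generator (f : Config L N → ℝ) (x : Config L N) (t : ℝ) :
    HasDerivAt (fun s : ℝ => NormedSpace.exp
        (s • LinearMap.toContinuousLinearMap (generator u₁ u₂ L N)) f x)
      (NormedSpace.exp (t • LinearMap.toContinuousLinearMap (generator u₁ u₂ L N))
        (generator u₁ u₂ L N f) x) t := by
  have h := hasDerivAt_exp_smul_const (𝕂 := ℝ)
    (LinearMap.toContinuousLinearMap (generator u₁ u₂ L N)) t
  have h2 := (h.clm_apply (hasDerivAt_const t f))
  have h3 := (hasDerivAt_pi.1 h2) x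
  simpa using h3

/-- Dynkin's formula in expectation: the fundamental theorem of calculus for exp(t𝔏)f. -/
theorem IsInclusionProcess.integral_generator (h : IsInclusionProcess P u₁ u₂ η₀ η)
    (f : Config L N → ℝ) {T : ℝ} (hT : 0 ≤ T) :
    ∫ t in (0 : ℝ)..T, ∫ ω, generator u₁ u₂ L N f (η t.toNNReal ω) ∂P =
      ∫ ω, f (η T.toNNReal ω) ∂P - f η₀ := by
  have key (g : Config L N → ℝ) (t : ℝ) (ht : 0 ≤ t) : ∫ ω, g (η t.toNNReal ω) ∂P =
      NormedSpace.exp (t • LinearMap.toContinuousLinearMap (generator u₁ u₂ L N)) g η₀ := by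
    rw [h.integral_comp_eq_semigroup, semigroup, Real.coe_toNNReal t ht]
  rw [intervalIntegral.integral_congr (g := fun t => NormedSpace.exp
    (t • LinearMap.toContinuousLinearMap (generator u₁ u₂ L N)) (generator u₁ u₂ L N f) η₀)]
  · rw [intervalIntegral.integral_eq_sub_of_hasDerivAt
      (fun t _ => hasDerivAt_exp_generator f η₀ t), key f T hT]
    · simp
    · exact (continuous_iff_continuousAt.2 fun t =>
        (hasDerivAt_exp_generator _ η₀ t).continuousAt).intervalIntegrable _ _
  · intro t ht
    rw [Set.uIcc_of_le hT] at ht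
    exact key _ t ht.1

theorem IsInclusionProcess.integrable_uncurry (h : IsInclusionProcess P u₁ u₂ η₀ η)
    (f : Config L N → ℝ) (T : ℝ) :
    Integrable (fun p : ℝ × Ω => f (η p.1.toNNReal p.2))
      ((volume.restrict (Set.uIoc 0 T)).prod P) := by
  obtain ⟨C, hC⟩ := (Set.finite_range fun x => ‖f x‖).bddAbove
  have : IsFiniteMeasure (volume.restrict (Set.uIoc 0 T)) := ⟨by simp [Set.uIoc]⟩
  exact Integrable.of_bound (h.measurable_uncurry f).aestronglyMeasurable C
    (Eventually.of_forall fun p => hC ⟨_, rfl⟩)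

theorem IsInclusionProcess.meas_ge_le (h : IsInclusionProcess P u₁ u₂ η₀ η)
    (f : Config L N → ℝ) (hf : ∀ x, 0 ≤ f x) {T : ℝ} (hT : 0 ≤ T) {ε : ℝ} (hε : 0 < ε) :
    P {ω | ε ≤ |∫ t in (0 : ℝ)..T, f (η t.toNNReal ω)|} ≤
      ENNReal.ofReal ((∫ t in (0 : ℝ)..T, ∫ ω, f (η t.toNNReal ω) ∂P) / ε) := by
  have hint := h.integrable_uncurry f T
  have hn (ω : Ω) : 0 ≤ ∫ t in (0 : ℝ)..T, f (η t.toNNReal ω) :=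
    intervalIntegral.integral_nonneg hT fun _ _ => hf _
  have hi : Integrable (fun ω => ∫ t in (0 : ℝ)..T, f (η t.toNNReal ω)) P := by
    have := hint.integral_prod_right
    simpa [intervalIntegral.integral_of_le hT, Set.uIoc_of_le hT] using this
  have hm := mul_meas_ge_le_integral_of_nonneg (Eventually.of_forall hn) hi ε
  rw [intervalIntegral_integral_swap (μ := P) (f := fun t ω => f (η t.toNNReal ω)) hint]
  simp only [abs_of_nonneg (hn _)]
  rw [← ofReal_measureReal]
  exact ENNReal.ofReal_le_ofReal ((le_div_iff₀' hε).2 hm)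
end InclusionProcess

/-! ### The concave profile and its weight. -/

namespace InclusionProcess

/-- The number `(n - A)⁺` of particles above the threshold. -/
def excess (A n : ℕ) : ℝ := ((n - A : ℕ) : ℝ)

/-- The bounded concave profile `k / (k + 1)`, `k = (n - A)⁺`. -/
noncomputable def profile (A n : ℕ) : ℝ := excess A n / (excess A n + 1)

/-- The weight `2 / ((k + 1) (k + 2))`, `k = (n - A)⁺`, of a site with `n > A` particles: this is
`-k` times the second difference of `k / (k + 1)`. -/
noncomputable def weight (A n : ℕ) : ℝ :=
  if A < n then 2 / ((excess A n + 1) * (excess A n + 2)) else 0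

theorem excess_nonneg (A n : ℕ) : 0 ≤ excess A n := Nat.cast_nonneg _

theorem excess_of_le {A n : ℕ} (h : n ≤ A) : excess A n = 0 := by
  simp [excess, Nat.sub_eq_zero_of_le h]

theorem one_le_excess {A n : ℕ} (h : A < n) : 1 ≤ excess A n := by
  unfold excess
  exact_mod_cast Nat.sub_pos_of_lt h

theorem excess_of_lt {A n : ℕ} (h : A < n) : excess A n = (n : ℝ) - A := by
  unfold excess
  rw [Nat.cast_sub h.le]

theorem excess_succ {A n : ℕ} (h : A ≤ n) : excess A (n + 1) = excess A n + 1 := by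
  unfold excess
  rw [Nat.sub_add_comm h]
  simp

theorem excess_le (A n : ℕ) : excess A n ≤ n := by
  unfold excess
  exact_mod_cast Nat.sub_le _ _

theorem profile_nonneg (A n : ℕ) : 0 ≤ profile A n :=
  div_nonneg (excess_nonneg A n) (by linarith [excess_nonneg A n])

theorem profile_le_one (A n : ℕ) : profile A n ≤ 1 :=
  (div_le_one (by linarith [excess_nonneg A n])).2 (by linarith)

theorem excess_mono (A : ℕ) : Monotone (excess A) := fun m n h => by
  unfold excess
  exact_mod_cast Nat.sub_le_sub_right h A

theorem profile_mono (A : ℕ) : Monotone (profile A) := fun m n h => by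
  have h1 := excess_mono A h
  have h2 := excess_nonneg A m
  unfold profile
  rw [div_le_div_iff₀ (by linarith) (by linarith)]
  linarith

theorem weight_nonneg (A n : ℕ) : 0 ≤ weight A n := by
  have := excess_nonneg A n
  unfold weight
  split_ifs <;> positivity

theorem excess_mul_profile_sub (A n : ℕ) :
    excess A n * ((profile A n - profile A (n - 1)) - (profile A (n + 1) - profile A n)) =
      weight A n := by
  unfold weight
  split_ifs with h
  · obtain ⟨m, rfl⟩ : ∃ m, n = m + 1 := ⟨n - 1, by omega⟩
    have hm : A ≤ m := by omega
    have h0 := excess_nonneg A m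
    simp only [profile, Nat.add_sub_cancel, excess_succ hm, excess_succ (hm.trans m.le_succ)]
    field_simp
    ring
  -- At n = A the second difference does not vanish; the factor `excess A n` kills it.
  · rw [excess_of_le (not_lt.1 h), zero_mul]

theorem excess_mul_weight_le_one (A n : ℕ) : excess A n * weight A n ≤ 1 := by
  have := excess_nonneg A n
  unfold weight
  split_ifs with h
  · rw [mul_div_assoc', div_le_one (by positivity)]
    nlinarith
  · simp

theorem weight_le_excess (A n : ℕ) : weight A n ≤ excess A n := by
  unfold weight
  split_ifs with h
  · have := one_le_excess h
    rw [div_le_iff₀ (by positivity)]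
    nlinarith [mul_nonneg (by linarith : (0 : ℝ) ≤ excess A n) (by linarith : (0 : ℝ) ≤ excess A n)]
  · exact excess_nonneg A n

/-- A site above the threshold either carries a large mass or has a weight bounded below. -/
theorem indicator_le_excess_add_weight (A n : ℕ) {K : ℝ} (hK : 0 < K) :
    (if A < n then (1 : ℝ) else 0) ≤ excess A n / K + (K + 1) * (K + 2) / 2 * weight A n := by
  have h0 := excess_nonneg A n
  have hw := weight_nonneg A n
  split_ifs with h
  · rcases le_total K (excess A n) with hk | hk
    · have : 1 ≤ excess A n / K := (one_le_div hK).2 hk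
      have : 0 ≤ (K + 1) * (K + 2) / 2 * weight A n := by positivity
      linarith
    · have h1 : 0 ≤ excess A n / K := by positivity
      have h2 : 1 ≤ (K + 1) * (K + 2) / 2 * weight A n := by
        rw [weight, if_pos h, div_mul_div_comm, mul_comm _ (2 : ℝ),
          mul_div_mul_left _ _ two_ne_zero, one_le_div (by positivity)]
        gcongr
      linarith
  · positivity

/-! ### Drift of the Lyapunov function and control of the site count. -/

variable {L N : ℕ}

theorem sum_moveFun_eq {i j : Fin L} (hij : i ≠ j) (η : Fin L → ℕ) (hi : η i ≠ 0) (g : ℕ → ℝ) :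
    ∑ k, g (moveFun i j η k) - ∑ k, g (η k) =
      (g (η j + 1) - g (η j)) - (g (η i) - g (η i - 1)) := by
  rw [← Finset.sum_sub_distrib, Fintype.sum_eq_add i j hij]
  · simp [moveFun, hi, hij, hij.symm]
    ring
  · rintro k ⟨hki, hkj⟩
    simp [moveFun, hi, hki, hkj]

/-- The Lyapunov function. -/
noncomputable def lyapunov (A : ℕ) (η : Config L N) : ℝ := ∑ i, profile A (η.1 i)

theorem moveFun_self (i : Fin L) (η : Fin L → ℕ) : moveFun i i η = η := by
  unfold moveFun
  split_ifs with h
  · rfl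
  · funext k
    split_ifs with hk
    · subst hk
      omega
    · simp

/-- The ideal term is kept on the diagonal too, so that the double sum factorises. There the true
contribution is 0 and the ideal one is -k times the weight, hence at least -1; this is the cost of
the indicator of i = j. -/
theorem rate_mul_lyapunov_sub_le {A : ℕ} {u₁ u₂ : ℕ → ℝ} {c : ℝ} (hc : 0 ≤ c)
    (h₁ : ∀ n, 1 ≤ n → |u₁ n - excess A n| ≤ c) (h₂ : ∀ n, |u₂ n - excess A n| ≤ c)
    (η : Config L N) (i j : Fin L) :
    u₁ (η.1 i) * u₂ (η.1 j) * (lyapunov A (η.move i j) - lyapunov A η) ≤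
      excess A (η.1 i) * excess A (η.1 j) *
        ((profile A (η.1 j + 1) - profile A (η.1 j)) -
          (profile A (η.1 i) - profile A (η.1 i - 1))) +
      (if i = j then 1 else 0) + (c * (excess A (η.1 i) + excess A (η.1 j)) + c ^ 2) := by
  have hki := excess_nonneg A (η.1 i)
  have hkj := excess_nonneg A (η.1 j)
  have herr : 0 ≤ c * (excess A (η.1 i) + excess A (η.1 j)) + c ^ 2 := by positivity
  by_cases hij : i = j
  · subst hij
    have h0 : η.move i i = η := Subtype.ext (moveFun_self i η.1)
    have h1 := excess_mul_profile_sub A (η.1 i)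
    have h2 := excess_mul_weight_le_one A (η.1 i)
    rw [h0, sub_self, mul_zero, if_pos rfl]
    rw [← h1] at h2
    nlinarith
  rw [if_neg hij, add_zero]
  by_cases hi : η.1 i = 0
  · have h0 : η.move i j = η := Subtype.ext (by simp [Config.move, moveFun, hi])
    rw [h0, sub_self, mul_zero, hi, excess_of_le (Nat.zero_le A), zero_mul, zero_mul, zero_add]
    positivity
  have hF : lyapunov A (η.move i j) - lyapunov A η =
      (profile A (η.1 j + 1) - profile A (η.1 j)) -
        (profile A (η.1 i) - profile A (η.1 i - 1)) :=
    sum_moveFun_eq hij η.1 hi (profile A)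
  rw [hF]
  set B := (profile A (η.1 j + 1) - profile A (η.1 j)) -
    (profile A (η.1 i) - profile A (η.1 i - 1)) with hB
  have hB1 : |B| ≤ 1 := by
    have a1 := profile_mono A (Nat.le_succ (η.1 j))
    have a2 := profile_mono A (Nat.sub_le (η.1 i) 1)
    have a3 := profile_le_one A (η.1 j + 1)
    have a4 := profile_le_one A (η.1 i)
    have a5 := profile_nonneg A (η.1 j)
    have a6 := profile_nonneg A (η.1 i - 1)
    rw [abs_le]
    constructor <;> linarith
  have e1 := h₁ (η.1 i) (Nat.one_le_iff_ne_zero.2 hi)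
  have e2 := h₂ (η.1 j)
  have hd : |u₁ (η.1 i) * u₂ (η.1 j) - excess A (η.1 i) * excess A (η.1 j)| ≤
      c * (excess A (η.1 i) + excess A (η.1 j)) + c ^ 2 := by
    have : u₁ (η.1 i) * u₂ (η.1 j) - excess A (η.1 i) * excess A (η.1 j) =
        (u₁ (η.1 i) - excess A (η.1 i)) * (u₂ (η.1 j) - excess A (η.1 j)) +
        (u₁ (η.1 i) - excess A (η.1 i)) * excess A (η.1 j) +
        excess A (η.1 i) * (u₂ (η.1 j) - excess A (η.1 j)) := by ring
    rw [this]
    refine (abs_add_three _ _ _).trans ?_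
    rw [abs_mul, abs_mul, abs_mul, abs_of_nonneg hki, abs_of_nonneg hkj]
    calc _ ≤ c * c + c * excess A (η.1 j) + excess A (η.1 i) * c := by gcongr
      _ = _ := by ring
  have hfin : (u₁ (η.1 i) * u₂ (η.1 j) - excess A (η.1 i) * excess A (η.1 j)) * B ≤
      c * (excess A (η.1 i) + excess A (η.1 j)) + c ^ 2 := by
    refine (le_abs_self _).trans ?_
    rw [abs_mul]
    exact (mul_le_of_le_one_right (abs_nonneg _) hB1).trans hd
  linarith

/-- The total mass above the threshold. -/
def totalExcess (A : ℕ) (η : Config L N) : ℝ := ∑ i, excess A (η.1 i)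

/-- The total weight of the sites above the threshold. -/
noncomputable def totalWeight (A : ℕ) (η : Config L N) : ℝ := ∑ i, weight A (η.1 i)

theorem totalWeight_nonneg (A : ℕ) (η : Config L N) : 0 ≤ totalWeight A η :=
  Finset.sum_nonneg fun _ _ => weight_nonneg A _

theorem totalExcess_le (A : ℕ) (η : Config L N) : totalExcess A η ≤ N :=
  (Finset.sum_le_sum fun i _ => excess_le A (η.1 i)).trans_eq (by exact_mod_cast η.2)

theorem totalWeight_le_totalExcess (A : ℕ) (η : Config L N) :
    totalWeight A η ≤ totalExcess A η :=
  Finset.sum_le_sum fun _ _ => weight_le_excess A _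

theorem lyapunov_nonneg (A : ℕ) (η : Config L N) : 0 ≤ lyapunov A η :=
  Finset.sum_nonneg fun _ _ => profile_nonneg A _

theorem lyapunov_le (A : ℕ) (η : Config L N) : lyapunov A η ≤ L :=
  (Finset.sum_le_sum fun _ _ => profile_le_one A _).trans_eq (by simp)

/-- The drift of the Lyapunov function. -/
theorem generator_lyapunov_le {A : ℕ} {u₁ u₂ : ℕ → ℝ} {c : ℝ} (hc : 0 ≤ c)
    (h₁ : ∀ n, 1 ≤ n → |u₁ n - excess A n| ≤ c) (h₂ : ∀ n, |u₂ n - excess A n| ≤ c)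
    (η : Config L N) :
    generator u₁ u₂ L N (lyapunov A) η ≤
      -(totalExcess A η * totalWeight A η) + (L + 2 * c * L * N + c ^ 2 * L ^ 2) := by
  have happ : generator u₁ u₂ L N (lyapunov A) η = ∑ i, ∑ j,
      u₁ (η.1 i) * u₂ (η.1 j) * (lyapunov A (η.move i j) - lyapunov A η) := rfl
  rw [happ]
  refine (Finset.sum_le_sum fun i _ => Finset.sum_le_sum fun j _ =>
    rate_mul_lyapunov_sub_le hc h₁ h₂ η i j).trans ?_
  have hmain : ∑ i, ∑ j, excess A (η.1 i) * excess A (η.1 j) *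
        ((profile A (η.1 j + 1) - profile A (η.1 j)) -
          (profile A (η.1 i) - profile A (η.1 i - 1))) =
      -(totalExcess A η * totalWeight A η) := by
    have hw : totalWeight A η = ∑ i, excess A (η.1 i) *
        ((profile A (η.1 i) - profile A (η.1 i - 1)) -
          (profile A (η.1 i + 1) - profile A (η.1 i))) :=
      Finset.sum_congr rfl fun i _ => (excess_mul_profile_sub A _).symm
    -- The rate k_i k_j is symmetric, so the loss at i can be moved to j, where it joins the gain in
    -- a second difference.
    have h1 : ∑ i, ∑ j, excess A (η.1 i) * excess A (η.1 j) *
        (profile A (η.1 i) - profile A (η.1 i - 1)) =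
        ∑ i, ∑ j, excess A (η.1 i) * excess A (η.1 j) *
        (profile A (η.1 j) - profile A (η.1 j - 1)) := by
      rw [Finset.sum_comm]
      exact Finset.sum_congr rfl fun i _ => Finset.sum_congr rfl fun j _ => by ring
    simp only [mul_sub (_ * _) (profile A _ - profile A _), Finset.sum_sub_distrib]
    rw [h1, hw, totalExcess, Finset.sum_mul_sum, ← Finset.sum_sub_distrib,
      ← Finset.sum_neg_distrib]
    refine Finset.sum_congr rfl fun i _ => ?_
    rw [← Finset.sum_sub_distrib, ← Finset.sum_neg_distrib]
    exact Finset.sum_congr rfl fun j _ => by ring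
  simp only [Finset.sum_add_distrib]
  rw [hmain]
  have hM := totalExcess_le A η
  have hs : ∑ i, ∑ j, c * (excess A (η.1 i) + excess A (η.1 j)) =
      2 * c * L * totalExcess A η := by
    simp only [mul_add, Finset.sum_add_distrib, Finset.sum_const, ← Finset.mul_sum, totalExcess,
      Finset.card_univ, Fintype.card_fin, nsmul_eq_mul]
    ring
  rw [hs]
  simp only [Finset.sum_ite_eq, Finset.mem_univ, if_true, Finset.sum_const, Finset.card_univ,
    Fintype.card_fin, nsmul_eq_mul, mul_one]
  have : 2 * c * L * totalExcess A η ≤ 2 * c * L * N := by gcongr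
  linarith [show (L : ℝ) * (L * c ^ 2) = c ^ 2 * L ^ 2 by ring]

theorem numAbove_le (A : ℕ) (η : Config L N) {K : ℝ} (hK : 0 < K) :
    (numAbove A η : ℝ) ≤ N / K + (K + 1) * (K + 2) / 2 * totalWeight A η := by
  have h : (numAbove A η : ℝ) = ∑ i, if A < η.1 i then (1 : ℝ) else 0 := by
    simp [numAbove]
  rw [h]
  refine (Finset.sum_le_sum fun i _ => indicator_le_excess_add_weight A (η.1 i) hK).trans ?_
  rw [Finset.sum_add_distrib, ← Finset.mul_sum, ← Finset.sum_div]
  gcongr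
  · exact totalExcess_le A η
  · exact le_rfl

/-- Young's inequality with S² ≤ M S trades the linear quantity S/L for δ plus a multiple of M S,
which the drift controls. -/
theorem numAbove_div_le (A : ℕ) (η : Config L N) (hL : 0 < L) {K δ : ℝ} (hK : 0 < K)
    (hδ : 0 < δ) :
    (numAbove A η : ℝ) / L ≤ (N / L / K + (K + 1) * (K + 2) / 2 * δ) +
      (K + 1) * (K + 2) / 2 / (δ * L ^ 2) * (totalExcess A η * totalWeight A η) := by
  have hL' : (0 : ℝ) < L := by exact_mod_cast hL
  have hS := totalWeight_nonneg A η
  have hSM := mul_le_mul_of_nonneg_right (totalWeight_le_totalExcess A η) hS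
  have h1 : totalWeight A η / L ≤ δ + totalExcess A η * totalWeight A η / (δ * L ^ 2) := by
    have h2 : δ + totalExcess A η * totalWeight A η / (δ * L ^ 2) =
        ((δ * L) ^ 2 + totalExcess A η * totalWeight A η) / (δ * L) / L := by
      field_simp
    rw [h2]
    gcongr
    rw [le_div_iff₀ (by positivity)]
    nlinarith [sq_nonneg (δ * L - totalWeight A η), mul_nonneg (mul_pos hδ hL').le hS]
  calc (numAbove A η : ℝ) / L
      ≤ (N / K + (K + 1) * (K + 2) / 2 * totalWeight A η) / L := by
        gcongr
        exact numAbove_le A η hK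
    _ = N / L / K + (K + 1) * (K + 2) / 2 * (totalWeight A η / L) := by ring
    _ ≤ N / L / K + (K + 1) * (K + 2) / 2 *
          (δ + totalExcess A η * totalWeight A η / (δ * L ^ 2)) := by gcongr
    _ = _ := by ring

/-- Both rates are uniformly close to the excess. -/
theorem SlowPhaseRates.exists_bound {A : ℕ} {u₁ u₂ : ℕ → ℕ → ℝ} (h : SlowPhaseRates A u₁ u₂) :
    ∃ C : ℝ, 0 ≤ C ∧ ∀ᶠ L : ℕ in atTop, (∀ n, 1 ≤ n → |u₁ L n - excess A n| ≤ C / L) ∧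
      ∀ n, |u₂ L n - excess A n| ≤ C / L := by
  obtain ⟨-, q, r, ζ, hζ, -, -, hr⟩ := h
  obtain ⟨c, hc0, hc⟩ := hζ.exists_nonneg
  -- A crude common bound for the finitely many slow-phase constants: slow rates are O(1/L), and the
  -- excess there is 0.
  let D := ∑ k ∈ Finset.range (A + 1), (|q k| + |r k|)
  have hD0 : 0 ≤ D := Finset.sum_nonneg fun _ _ => by positivity
  have hD (k : ℕ) (hk : k ≤ A) : |q k| + |r k| ≤ D :=
    Finset.single_le_sum (f := fun k => |q k| + |r k|) (fun _ _ => by positivity)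
      (Finset.mem_range.2 (Nat.lt_succ_of_le hk))
  refine ⟨D + c, by positivity, ?_⟩
  filter_upwards [hc.bound, eventually_ge_atTop 1] with L hL hL1
  have hL' : (1 : ℝ) ≤ L := by exact_mod_cast hL1
  have hz : ζ L ≤ c / L := by
    refine (le_abs_self _).trans (hL.trans_eq ?_)
    rw [Real.norm_of_nonneg (by positivity)]
    ring
  have hzc : ζ L ≤ c := hz.trans (div_le_self hc0 hL')
  have hcL : c / L ≤ (D + c) / L := by gcongr; linarith
  have slow {u a : ℝ} (ha : |a| ≤ D) (hu : |u * L - a| ≤ ζ L) : |u| ≤ (D + c) / L := by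
    rw [le_div_iff₀ (by linarith)]
    calc |u| * L = |a + (u * L - a)| := by
          rw [add_sub_cancel, abs_mul, abs_of_nonneg (by linarith : (0 : ℝ) ≤ L)]
      _ ≤ |a| + |u * L - a| := abs_add_le _ _
      _ ≤ D + c := by linarith
  obtain ⟨h1, h2, h3⟩ := hr L hL1
  constructor
  · intro n hn
    rcases le_or_gt n A with hA | hA
    · rw [excess_of_le hA, sub_zero]
      exact slow (by linarith [hD n hA, abs_nonneg (r n)]) (h1 n hn hA)
    · rw [excess_of_lt hA]
      exact (h3 n hA).1.trans (hz.trans hcL)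
  · intro n
    rcases le_or_gt n A with hA | hA
    · rw [excess_of_le hA, sub_zero]
      exact slow (by linarith [hD n hA, abs_nonneg (q n)]) (h2 n hA)
    · rw [excess_of_lt hA]
      exact (h3 n hA).2.trans (hz.trans hcL)

end InclusionProcess

/-! ### Expected occupation density and the thermodynamic limit. -/

namespace InclusionProcess

variable {Ω : Type*} [MeasurableSpace Ω] {P : Measure Ω} [IsProbabilityMeasure P]
  {u₁ u₂ : ℕ → ℝ} {L N : ℕ} {η₀ : Config L N} {η : ℝ≥0 → Ω → Config L N}

theorem IsInclusionProcess.integrable_comp (h : IsInclusionProcess P u₁ u₂ η₀ η)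
    (f : Config L N → ℝ) (t : ℝ≥0) : Integrable (fun ω => f (η t ω)) P :=
  (Integrable.of_finite (μ := P.map (η t)) (f := f)).comp_measurable (h.measurable t)

theorem IsInclusionProcess.intervalIntegrable (h : IsInclusionProcess P u₁ u₂ η₀ η)
    (f : Config L N → ℝ) {T : ℝ} (hT : 0 ≤ T) :
    IntervalIntegrable (fun t : ℝ => ∫ ω, f (η t.toNNReal ω) ∂P) volume 0 T := by
  rw [intervalIntegrable_iff_integrableOn_Ioc_of_le hT, ← Set.uIoc_of_le hT]
  exact (h.integrable_uncurry f T).integral_prod_left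

/-- The sign of b is free: the drift bound enters with b = -1. -/
theorem IsInclusionProcess.integral_le_of_le (h : IsInclusionProcess P u₁ u₂ η₀ η)
    {f g : Config L N → ℝ} {a b : ℝ} (hfg : ∀ x, f x ≤ a + b * g x) {T : ℝ} (hT : 0 ≤ T) :
    ∫ t in (0 : ℝ)..T, ∫ ω, f (η t.toNNReal ω) ∂P ≤
      T * a + b * ∫ t in (0 : ℝ)..T, ∫ ω, g (η t.toNNReal ω) ∂P := by
  have hi := (h.intervalIntegrable g hT).const_mul b
  calc ∫ t in (0 : ℝ)..T, ∫ ω, f (η t.toNNReal ω) ∂P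
      ≤ ∫ t in (0 : ℝ)..T, (a + b * ∫ ω, g (η t.toNNReal ω) ∂P) := by
        refine intervalIntegral.integral_mono_on hT (h.intervalIntegrable f hT)
          (intervalIntegrable_const.add hi) fun t _ => ?_
        refine (integral_mono (h.integrable_comp f _)
          ((integrable_const a).add ((h.integrable_comp g _).const_mul b))
          fun ω => hfg _).trans_eq ?_
        rw [integral_add' (integrable_const a) ((h.integrable_comp g _).const_mul b),
          integral_const_mul]
        simp
    _ = _ := by
        rw [intervalIntegral.integral_add intervalIntegrable_const hi,
          intervalIntegral.integral_const_mul]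
        simp

theorem IsInclusionProcess.integral_totalExcess_mul_totalWeight_le
    (h : IsInclusionProcess P u₁ u₂ η₀ η) {A : ℕ} {c : ℝ} (hc : 0 ≤ c)
    (h₁ : ∀ n, 1 ≤ n → |u₁ n - excess A n| ≤ c) (h₂ : ∀ n, |u₂ n - excess A n| ≤ c)
    {T : ℝ} (hT : 0 ≤ T) :
    ∫ t in (0 : ℝ)..T, ∫ ω,
        totalExcess A (η t.toNNReal ω) * totalWeight A (η t.toNNReal ω) ∂P ≤
      L + T * (L + 2 * c * L * N + c ^ 2 * L ^ 2) := by
  have h3 := h.integral_le_of_le (f := generator u₁ u₂ L N (lyapunov A))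
    (g := fun x => totalExcess A x * totalWeight A x) (b := -1)
    (a := L + 2 * c * L * N + c ^ 2 * L ^ 2)
    (fun x => (generator_lyapunov_le hc h₁ h₂ x).trans_eq (by ring)) hT
  rw [h.integral_generator _ hT] at h3
  have h4 : 0 ≤ ∫ ω, lyapunov A (η T.toNNReal ω) ∂P :=
    integral_nonneg fun _ => lyapunov_nonneg A _
  have h5 := lyapunov_le A η₀
  linarith

/-- Bound on the expected occupation density above the threshold. -/
theorem IsInclusionProcess.integral_numAbove_div_le
    (h : IsInclusionProcess P u₁ u₂ η₀ η) {A : ℕ} {C : ℝ} (hC : 0 ≤ C) (hL : 0 < L)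
    (h₁ : ∀ n, 1 ≤ n → |u₁ n - excess A n| ≤ C / L) (h₂ : ∀ n, |u₂ n - excess A n| ≤ C / L)
    {T : ℝ} (hT : 0 ≤ T) {K δ : ℝ} (hK : 0 < K) (hδ : 0 < δ) :
    ∫ t in (0 : ℝ)..T, ∫ ω, (numAbove A (η t.toNNReal ω) : ℝ) / L ∂P ≤
      T * (N / L / K + (K + 1) * (K + 2) / 2 * δ) + (K + 1) * (K + 2) / 2 / δ *
        ((1 + T * (1 + 2 * C * (N / L) + C * (C / L))) / L) := by
  have hL' : (0 : ℝ) < L := by exact_mod_cast hL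
  refine (h.integral_le_of_le (f := fun x => (numAbove A x : ℝ) / L)
    (g := fun x => totalExcess A x * totalWeight A x)
    (fun x => numAbove_div_le A x hL hK hδ) hT).trans (add_le_add_right ?_ _)
  refine (mul_le_mul_of_nonneg_left (h.integral_totalExcess_mul_totalWeight_le
    (by positivity) h₁ h₂ hT) (by positivity)).trans_eq ?_
  field_simp

theorem tendsto_integral_numAbove_div
    {A : ℕ} {u₁ u₂ : ℕ → ℕ → ℝ} (hu : SlowPhaseRates A u₁ u₂) {ρ : ℝ} (hρ : 0 < ρ) {L N : ℕ → ℕ}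
    (hL : Tendsto L atTop atTop)
    (hLN : Tendsto (fun n => (N n : ℝ) / (L n : ℝ)) atTop (𝓝 ρ))
    {η₀ : ∀ n, Config (L n) (N n)} {Ω : ℕ → Type*} [∀ n, MeasurableSpace (Ω n)]
    {P : ∀ n, Measure (Ω n)} [∀ n, IsProbabilityMeasure (P n)]
    {η : ∀ n, ℝ≥0 → Ω n → Config (L n) (N n)}
    (hη : ∀ n, IsInclusionProcess (P n) (u₁ (L n)) (u₂ (L n)) (η₀ n) (η n))
    {T : ℝ} (hT : 0 < T) :
    Tendsto (fun n => ∫ t in (0 : ℝ)..T, ∫ ω, (numAbove A (η n t.toNNReal ω) : ℝ) / (L n) ∂(P n))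
      atTop (𝓝 0) := by
  obtain ⟨C, hC, hbound⟩ := hu.exists_bound
  refine tendsto_order.2 ⟨fun a ha => Eventually.of_forall fun n => ha.trans_le
    (intervalIntegral.integral_nonneg hT.le fun t _ => integral_nonneg fun ω => by positivity),
    fun ε hε => ?_⟩
  -- K and then δ are chosen so that each of the two surviving terms equals ε/3 in the limit.
  let K : ℝ := 3 * T * ρ / ε
  have hK : 0 < K := by positivity
  let δ : ℝ := ε / (3 * T * ((K + 1) * (K + 2) / 2))
  have hδ : 0 < δ := by positivity
  have hlim : T * (ρ / K + (K + 1) * (K + 2) / 2 * δ) < ε := by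
    have e1 : ρ / K = ε / (3 * T) := by
      simp only [K]
      field_simp
    have e2 : (K + 1) * (K + 2) / 2 * δ = ε / (3 * T) := by
      simp only [δ]
      field_simp
    rw [e1, e2]
    field_simp
    norm_num
  have hLr : Tendsto (fun n => (L n : ℝ)) atTop atTop := tendsto_natCast_atTop_atTop.comp hL
  have ht : Tendsto (fun n => T * ((N n : ℝ) / L n / K + (K + 1) * (K + 2) / 2 * δ) +
      (K + 1) * (K + 2) / 2 / δ * ((1 + T * (1 + 2 * C * ((N n : ℝ) / L n) + C * (C / L n))) / L n))
      atTop (𝓝 (T * (ρ / K + (K + 1) * (K + 2) / 2 * δ) + (K + 1) * (K + 2) / 2 / δ * 0)) := by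
    refine (((hLN.div_const K).add_const _).const_mul T).add (Tendsto.const_mul _ ?_)
    refine Tendsto.div_atTop (a := 1 + T * (1 + 2 * C * ρ + C * 0)) ?_ hLr
    exact (((((hLN.const_mul (2 * C)).const_add 1).add
      ((tendsto_const_nhds.div_atTop hLr).const_mul C)).const_mul T).const_add 1)
  rw [mul_zero, add_zero] at ht
  filter_upwards [ht.eventually_lt_const hlim, hL.eventually hbound,
    hL.eventually (eventually_gt_atTop 0)] with n h1 h2 h3
  exact ((hη n).integral_numAbove_div_le hC h3 h2.1 h2.2 hT.le hK hδ).trans_lt h1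

end InclusionProcess

theorem proposition4p2
    -- threshold and rates
    (A : ℕ) (u₁ u₂ : ℕ → ℕ → ℝ) (hu : InclusionProcess.SlowPhaseRates A u₁ u₂)
    -- thermodynamic limit
    (ρ : ℝ) (hρ : 0 < ρ) (L N : ℕ → ℕ)
    (hL : Tendsto L atTop atTop) (hN : Tendsto N atTop atTop)
    (hLN : Tendsto (fun n => (N n : ℝ) / (L n : ℝ)) atTop (𝓝 ρ))
    -- deterministic initial configurations with convergent fast-phase mass fraction
    (η₀ : ∀ n, InclusionProcess.Config (L n) (N n))
    (hγ : ∃ g ∈ Set.Icc (0 : ℝ) 1,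
      Tendsto (fun n => InclusionProcess.fastMass A (η₀ n)) atTop (𝓝 g))
    -- inclusion processes started from these configurations
    (Ω : ℕ → Type*) [∀ n, MeasurableSpace (Ω n)]
    (P : ∀ n, Measure (Ω n)) [∀ n, IsProbabilityMeasure (P n)]
    (η : ∀ n, ℝ≥0 → Ω n → InclusionProcess.Config (L n) (N n))
    (hη : ∀ n, InclusionProcess.IsInclusionProcess (P n) (u₁ (L n)) (u₂ (L n)) (η₀ n) (η n))
    (T : ℝ) (hT : 0 < T) :
    ∀ ε : ℝ, 0 < ε →
      Tendsto (fun n => P n {ω | ε ≤ |∫ t in (0 : ℝ)..T,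
        (InclusionProcess.numAbove A (η n t.toNNReal ω) : ℝ) / (L n : ℝ)|}) atTop (𝓝 0) := by
  intro ε hε
  have h := InclusionProcess.tendsto_integral_numAbove_div hu hρ hL hLN hη hT
  have h2 := ENNReal.tendsto_ofReal (h.div_const ε)
  rw [zero_div, ENNReal.ofReal_zero] at h2
  exact tendsto_of_tendsto_of_tendsto_of_le_of_le tendsto_const_nhds h2 (fun _ => zero_le)
    fun n => (hη n).meas_ge_le (fun x => (InclusionProcess.numAbove A x : ℝ) / (L n : ℝ))
      (fun x => by positivity) hT.le hε
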